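/- Fix a countable set $P$ of propositional letters, and let the atomic formulae be the letters in $P$ together with the two distinguished atoms $\top$ and $\bot$. Let $\mathcal L$ be the least set of formulae containing the atomic formulae and closed under $\wedge$, $\neg$, $\Box$ and $\mathsf K$; other propositional connectives are the usual abbreviations, $\Diamond\phi:=\neg\Box\neg\phi$ and $\mathsf L\phi:=\neg\mathsf K\neg\phi$. The system $\mathbf{MP}^*$ has as axioms, for all $\phi,\psi,\chi\in\mathcal L$ and all atomic $A$: 1. all (instances of) propositional tautologies, with $\top$ read as true and $\bot$ as false; 2. $(A\to\Box A)\wedge(\neg A\to\Box\neg A)$; 3. $\Box(\phi\to\psi)\to(\Box\phi\to\Box\psi)$, $\ \Box\phi\to\phi$, $\ \Box\phi\to\Box\Box\phi$; 4. $\mathsf K(\phi\to\psi)\to(\mathsf K\phi\to\mathsf K\psi)$, $\ \mathsf K\phi\to\phi$, $\ \mathsf K\phi\to\mathsf K\mathsf K\phi$, $\ \phi\to\mathsf K\mathsf L\phi$; 5. $\mathsf K\Box\phi\to\Box\mathsf K\phi$; 6. $\Diamond\Box\phi\to\Box\Diamond\phi$; 7. $\Diamond(\mathsf K\phi\wedge\psi)\wedge\mathsf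 L\Diamond(\mathsf K\phi\wedge\chi)\to\Diamond(\mathsf K\Diamond\phi\wedge\Diamond\psi\wedge\mathsf L\Diamond\chi)$; and as rules modus ponens and necessitation for $\mathsf K$ and for $\Box$ (from $\phi$ infer $\mathsf K\phi$; from $\phi$ infer $\Box\phi$). Write $\vdash_{\mathbf{MP}^*}\phi$ if $\phi$ is a theorem of this system. Let $\mathcal L'\subseteq\mathcal L$ be the least set of formulae containing all atomic formulae and closed under $\wedge$, $\neg$ and $\phi\mapsto\Diamond\mathsf K\phi$. **Proposition.** Let $n\ge 1$ and $\phi_1,\dots,\phi_n\in\mathcal L'$. (a) If $\vdash_{\mathbf{MP}^*}\mathsf K\phi_1\vee\dots\vee\mathsf K\phi_n$, then $\vdash_{\mathbf{MP}^*}\phi_i$ for some $i$ with $1\le i\le n$. (b) For every $\phi\in\mathcal L'$, if $\vdash_{\mathbf{MP}^*}\mathsf K\phi\to\mathsf K\phi_1\vee\dots\vee\mathsf K\phi_n$, then $\vdash_{\mathbf{MP}^*}\mathsf K\phi\to\phi_i$ for some $i$ with $1\le i\le n$. -/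

import Mathlib

namespace TopologicMP

/-- Atomic formulae over a set `P` of propositional letters: the letters, together with the two
distinguished atoms `⊤` and `⊥`. -/
inductive Atom (P : Type*) where
  | top : Atom P
  | bot : Atom P
  | letter : P → Atom P

/-- The bimodal language generated from the atoms by conjunction, negation and the
modalities `□` and `K`. -/
inductive Formula (P : Type*) where
  | atom : Atom P → Formula P
  | and : Formula P → Formula P → Formula P
  | neg : Formula P → Formula P
  | box : Formula P → Formula P
  | know : Formula P → Formula P

namespace Formula

variable {P : Type*}

/-- `φ ∨ ψ` abbreviates `¬(¬φ ∧ ¬ψ)`. -/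
def or (φ ψ : Formula P) : Formula P := neg (and (neg φ) (neg ψ))

/-- `φ → ψ` abbreviates `¬(φ ∧ ¬ψ)`. -/
def imp (φ ψ : Formula P) : Formula P := neg (and φ (neg ψ))

/-- `◇φ` abbreviates `¬□¬φ`. -/
def dia (φ : Formula P) : Formula P := neg (box (neg φ))

/-- `Lφ` abbreviates `¬K¬φ`. -/
def poss (φ : Formula P) : Formula P := neg (know (neg φ))

/-- The disjunction `φ₁ ∨ (φ₂ ∨ (⋯ ∨ φₙ))` of a list of formulae
(by convention `⊥` for the empty list). -/
def disj : List (Formula P) → Formula P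
  | [] => atom Atom.bot
  | [φ] => φ
  | φ :: ψ :: l => or φ (disj (ψ :: l))

/-- `φ` is a propositional tautology: it is true under every truth assignment to all formulae that
respects `⊤`, `⊥`, `∧`, `¬`. The assignment is unconstrained on letters and on formulae `□φ`, `Kφ`,
so substitution instances of propositional tautologies are included. -/
def IsTautology (φ : Formula P) : Prop :=
  ∀ v : Formula P → Prop,
    v (atom Atom.top) → ¬ v (atom Atom.bot) →
    (∀ α β, v (and α β) ↔ v α ∧ v β) → (∀ α, v (neg α) ↔ ¬ v α) → v φ

/-- The fragment `L'`: the least set of formulae containing all atoms and closed under `∧`, `¬`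
and `◇K`. -/
inductive InLPrime : Formula P → Prop
  | atom (a : Atom P) : InLPrime (atom a)
  | and {φ ψ : Formula P} : InLPrime φ → InLPrime ψ → InLPrime (and φ ψ)
  | neg {φ : Formula P} : InLPrime φ → InLPrime (neg φ)
  | diaKnow {φ : Formula P} : InLPrime φ → InLPrime (dia (know φ))

end Formula

open Formula in
/-- Theoremhood in the Hilbert-style system `MP*`. -/
inductive MPStar {P : Type*} : Formula P → Prop
  | taut {φ : Formula P} : IsTautology φ → MPStar φ
  | atomPersistent (a : Atom P) :
      MPStar (and (imp (atom a) (box (atom a))) (imp (neg (atom a)) (box (neg (atom a)))))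
  | boxDistrib (φ ψ : Formula P) : MPStar (imp (box (imp φ ψ)) (imp (box φ) (box ψ)))
  | boxRefl (φ : Formula P) : MPStar (imp (box φ) φ)
  | boxTrans (φ : Formula P) : MPStar (imp (box φ) (box (box φ)))
  | knowDistrib (φ ψ : Formula P) : MPStar (imp (know (imp φ ψ)) (imp (know φ) (know ψ)))
  | knowRefl (φ : Formula P) : MPStar (imp (know φ) φ)
  | knowTrans (φ : Formula P) : MPStar (imp (know φ) (know (know φ)))
  | knowSymm (φ : Formula P) : MPStar (imp φ (know (poss φ)))
  | cross (φ : Formula P) : MPStar (imp (know (box φ)) (box (know φ)))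
  | directed (φ : Formula P) : MPStar (imp (dia (box φ)) (box (dia φ)))
  | union (φ ψ χ : Formula P) :
      MPStar (imp
        (and (dia (and (know φ) ψ)) (poss (dia (and (know φ) χ))))
        (dia (and (and (know (dia φ)) (dia ψ)) (poss (dia χ)))))
  | modusPonens {φ ψ : Formula P} : MPStar (imp φ ψ) → MPStar φ → MPStar ψ
  | knowNec {φ : Formula P} : MPStar φ → MPStar (know φ)
  | boxNec {φ : Formula P} : MPStar φ → MPStar (box φ)

end TopologicMP

namespace TopologicMP

open Formula

variable {P : Type*}

/-! On `L'` the truth of a formula at `(x, U)` depends only on `x`, and `◇K` behaves like an S4 box.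
Maximal consistent theories, ordered by `World.Rel` and given the topology of closed sets of that
relation, therefore form a model in which truth of `L'`-formulae is membership
(`sat_canonical_iff`). Only soundness for topological spaces is needed, not completeness for the
whole language. If no `Kφ → φᵢ` is provable, some world `wᵢ` satisfies `◇Kφ` but not `φᵢ`. The
worlds satisfying `◇Kφ` form a single open set containing all the `wᵢ`; relative to it `Kφ` is true
and every `Kφᵢ` false, so `Kφ → ⋁ Kφᵢ` is not provable. -/

/-- An assignment of truth values to all formulae which respects `⊤`, `⊥`, `∧` and `¬`. -/
structure IsBooleanValuation (v : Formula P → Prop) : Prop where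
  top : v (atom Atom.top)
  bot : ¬ v (atom Atom.bot)
  and : ∀ α β, v (and α β) ↔ v α ∧ v β
  neg : ∀ α, v (neg α) ↔ ¬ v α

theorem IsBooleanValuation.imp {v : Formula P → Prop} (hv : IsBooleanValuation v)
    (α β : Formula P) : v (imp α β) ↔ (v α → v β) := by
  simp only [Formula.imp, hv.neg, hv.and]; tauto

theorem IsBooleanValuation.or {v : Formula P → Prop} (hv : IsBooleanValuation v)
    (α β : Formula P) : v (or α β) ↔ (v α ∨ v β) := by
  simp only [Formula.or, hv.neg, hv.and]; tauto

theorem IsBooleanValuation.disj {v : Formula P → Prop} (hv : IsBooleanValuation v) :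
    ∀ l : List (Formula P), v (disj l) ↔ ∃ α ∈ l, v α
  | [] => by simp [Formula.disj, hv.bot]
  | [α] => by simp [Formula.disj]
  | α :: β :: l => by
    rw [Formula.disj, hv.or, hv.disj (β :: l)]
    simp

theorem MPStar.of_valuation {φ : Formula P}
    (h : ∀ v : Formula P → Prop, IsBooleanValuation v → v φ) : MPStar φ :=
  .taut fun v ht hb ha hn => h v ⟨ht, hb, ha, hn⟩

/-! ### Soundness for topological spaces -/

/-- Truth of a formula at a point `x` and an open set `U` of a topological space. -/
def Sat {X : Type*} [TopologicalSpace X] (V : P → Set X) : X → Set X → Formula P → Prop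
  | _, _, atom Atom.top => True
  | _, _, atom Atom.bot => False
  | x, _, atom (Atom.letter p) => x ∈ V p
  | x, U, Formula.and φ ψ => Sat V x U φ ∧ Sat V x U ψ
  | x, U, Formula.neg φ => ¬ Sat V x U φ
  | x, U, box φ => ∀ W, IsOpen W → W ⊆ U → x ∈ W → Sat V x W φ
  | _, U, know φ => ∀ y ∈ U, Sat V y U φ

section Soundness

variable {X : Type*} [TopologicalSpace X] {V : P → Set X} {x : X} {U : Set X}

theorem isBooleanValuation_sat : IsBooleanValuation (Sat V x U) where
  top := by simp [Sat]
  bot := by simp [Sat]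
  and _ _ := by simp [Sat]
  neg _ := by simp [Sat]

theorem sat_imp {φ ψ : Formula P} : Sat V x U (imp φ ψ) ↔ (Sat V x U φ → Sat V x U ψ) :=
  isBooleanValuation_sat.imp φ ψ

theorem sat_dia {φ : Formula P} :
    Sat V x U (dia φ) ↔ ∃ W, IsOpen W ∧ W ⊆ U ∧ x ∈ W ∧ Sat V x W φ := by
  simp [dia, Sat]

theorem sat_poss {φ : Formula P} : Sat V x U (poss φ) ↔ ∃ y ∈ U, Sat V y U φ := by
  simp [poss, Sat]

theorem sat_atom_iff (a : Atom P) (U W : Set X) :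
    Sat V x U (atom a) ↔ Sat V x W (atom a) := by
  cases a <;> simp [Sat]

/-- Closure of open sets under intersection validates `directed`, closure under union validates
`union`. -/
theorem MPStar.sat {φ : Formula P} (h : MPStar φ) :
    ∀ x U, IsOpen U → x ∈ U → Sat V x U φ := by
  induction h with
  | taut h =>
    intro x U _ _
    have hv := isBooleanValuation_sat (V := V) (x := x) (U := U)
    exact h _ hv.top hv.bot hv.and hv.neg
  | atomPersistent a =>
    intro x U _ _
    refine ⟨sat_imp.2 fun h W _ _ _ => (sat_atom_iff a U W).1 h,
      sat_imp.2 fun h W _ _ _ hW => h ((sat_atom_iff a U W).2 hW)⟩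
  | boxDistrib φ ψ =>
    intro x U _ _
    simp only [sat_imp, Sat]
    exact fun h h' W hW hWU hx => h W hW hWU hx (h' W hW hWU hx)
  | boxRefl φ =>
    intro x U hU hx
    simp only [sat_imp, Sat]
    exact fun h => h U hU subset_rfl hx
  | boxTrans φ =>
    intro x U _ _
    simp only [sat_imp, Sat]
    exact fun h W _ hWU _ W' hW' hWW' hx' => h W' hW' (hWW'.trans hWU) hx'
  | knowDistrib φ ψ =>
    intro x U _ _
    simp only [sat_imp, Sat]
    exact fun h h' y hy => h y hy (h' y hy)
  | knowRefl φ =>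
    intro x U _ hx
    simp only [sat_imp, Sat]
    exact fun h => h x hx
  | knowTrans φ =>
    intro x U _ _
    simp only [sat_imp, Sat]
    exact fun h _ _ => h
  | knowSymm φ =>
    intro x U _ hx
    simp only [sat_imp, Sat, sat_poss]
    exact fun h _ _ => ⟨x, hx, h⟩
  | cross φ =>
    intro x U _ _
    simp only [sat_imp, Sat]
    exact fun h W hW hWU _ y hy => h y (hWU hy) W hW hWU hy
  | directed φ =>
    intro x U _ _
    simp only [sat_imp, Sat, sat_dia]
    rintro ⟨W, hW, _, hx, h⟩ W' hW' _ hx'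
    exact ⟨W ∩ W', hW.inter hW', Set.inter_subset_right, ⟨hx, hx'⟩,
      h _ (hW.inter hW') Set.inter_subset_left ⟨hx, hx'⟩⟩
  | union φ ψ χ =>
    intro x U _ _
    simp only [sat_imp, Sat, sat_dia, sat_poss]
    rintro ⟨⟨W, hW, hWU, hx, hφ, hψ⟩, y, _, W', hW', hWU', hy, hφ', hχ⟩
    refine ⟨W ∪ W', hW.union hW', Set.union_subset hWU hWU', .inl hx,
      ⟨?_, W, hW, Set.subset_union_left, hx, hψ⟩,
      y, .inr hy, W', hW', Set.subset_union_right, hy, hχ⟩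
    rintro z (hz | hz)
    · exact ⟨W, hW, Set.subset_union_left, hz, hφ z hz⟩
    · exact ⟨W', hW', Set.subset_union_right, hz, hφ' z hz⟩
  | modusPonens _ _ ih ih' =>
    exact fun x U hU hx => sat_imp.1 (ih x U hU hx) (ih' x U hU hx)
  | knowNec _ ih => exact fun x U hU _ y hy => ih y U hU hy
  | boxNec _ ih => exact fun x U _ _ W hW _ hx => ih x W hW hx

end Soundness

/-! ### Worlds: maximal consistent theories -/

/-- Derivability from hypotheses by theorems and modus ponens. -/
inductive Derives (S : Set (Formula P)) : Formula P → Prop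
  | hyp {φ : Formula P} : φ ∈ S → Derives S φ
  | thm {φ : Formula P} : MPStar φ → Derives S φ
  | mp {φ ψ : Formula P} : Derives S (imp φ ψ) → Derives S φ → Derives S ψ

theorem Derives.deduction {S : Set (Formula P)} {α β : Formula P}
    (h : Derives (insert α S) β) : Derives S (imp α β) := by
  induction h with
  | @hyp φ h =>
    rcases h with rfl | h
    · exact .thm (.of_valuation fun v hv => by simp [hv.imp])
    · exact .mp (.thm (.of_valuation fun v hv => by simp only [hv.imp]; tauto)) (.hyp h)
  | thm h =>
    exact .thm (.modusPonens (.of_valuation fun v hv => by simp only [hv.imp]; tauto) h)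
  | @mp φ ψ _ _ ih ih' =>
    refine .mp (.mp (.thm ?_) ih) ih'
    exact .of_valuation fun v hv => by simp only [hv.imp]; tauto

theorem Derives.exists_of_chain {c : Set (Set (Formula P))} (hc : IsChain (· ⊆ ·) c)
    (hne : c.Nonempty) {φ : Formula P} (h : Derives (⋃₀ c) φ) : ∃ S ∈ c, Derives S φ := by
  have mono {S T : Set (Formula P)} (hST : S ⊆ T) {α : Formula P} (h : Derives S α) :
      Derives T α := by
    induction h with
    | hyp h => exact .hyp (hST h)
    | thm h => exact .thm h
    | mp _ _ ih ih' => exact .mp ih ih'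
  induction h with
  | hyp h =>
    obtain ⟨S, hS, h⟩ := h
    exact ⟨S, hS, .hyp h⟩
  | thm h =>
    obtain ⟨S, hS⟩ := hne
    exact ⟨S, hS, .thm h⟩
  | mp _ _ ih ih' =>
    obtain ⟨S, hS, h⟩ := ih
    obtain ⟨T, hT, h'⟩ := ih'
    rcases hc.total hS hT with hST | hTS
    · exact ⟨T, hT, .mp (mono hST h) h'⟩
    · exact ⟨S, hS, .mp h (mono hTS h')⟩

/-- The worlds of the canonical model: Boolean valuations satisfying all theorems. -/
structure World (P : Type*) where
  holds : Formula P → Prop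
  isBooleanValuation : IsBooleanValuation holds
  of_mpStar : ∀ {φ}, MPStar φ → holds φ

theorem World.mp (w : World P) {α β : Formula P} (h : MPStar (imp α β)) (hα : w.holds α) :
    w.holds β :=
  (w.isBooleanValuation.imp α β).1 (w.of_mpStar h) hα

/-- Lindenbaum's lemma. -/
theorem exists_world {S : Set (Formula P)} {φ : Formula P} (hS : ¬ Derives S φ) :
    ∃ w : World P, (∀ α ∈ S, w.holds α) ∧ ¬ w.holds φ := by
  obtain ⟨M, hSM, hM⟩ := zorn_subset_nonempty {T : Set (Formula P) | ¬ Derives T φ}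
    (fun c hc hchain hne => ⟨⋃₀ c, fun h => by
      obtain ⟨T, hT, h⟩ := h.exists_of_chain hchain hne
      exact hc hT h, fun T hT => Set.subset_sUnion_of_mem hT⟩) S hS
  have hcons : ¬ Derives M φ := hM.prop
  -- `M` is maximal among sets not deriving `φ`, so `φ` plays the role of falsity.
  have himp : ∀ α, α ∉ M → Derives M (imp α φ) := fun α hα => by
    by_contra h
    exact hα (hM.le_of_ge (y := insert α M) (fun h' => h h'.deduction)
      (Set.subset_insert _ _) (Set.mem_insert _ _))
  have hclosed : ∀ α, Derives M α → α ∈ M := fun α hα => by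
    by_contra h
    exact hcons (.mp (himp α h) hα)
  have hthm : ∀ α, MPStar α → α ∈ M := fun α h => hclosed α (.thm h)
  have hmp : ∀ α β, MPStar (imp α β) → α ∈ M → β ∈ M := fun α β h hα =>
    hclosed β (.mp (.thm h) (.hyp hα))
  refine ⟨⟨(· ∈ M), ⟨?_, ?_, ?_, ?_⟩, fun h => hthm _ h⟩, fun α hα => hSM hα,
    fun h => hcons (.hyp h)⟩
  · exact hthm _ (.of_valuation fun v hv => hv.top)
  · exact fun h => hcons (.mp (.thm (.of_valuation fun v hv => by simp [hv.imp, hv.bot]))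
      (.hyp h))
  · refine fun α β => ⟨fun h => ⟨hmp _ _ ?_ h, hmp _ _ ?_ h⟩, fun ⟨h, h'⟩ =>
      hclosed _ (.mp (.mp (.thm ?_) (.hyp h)) (.hyp h'))⟩
    all_goals exact .of_valuation fun v hv => by simp only [hv.imp, hv.and]; tauto
  · refine fun α => ⟨fun h h' => hcons (.mp (.mp (.thm ?_) (.hyp h)) (.hyp h')), fun h => ?_⟩
    · exact .of_valuation fun v hv => by simp only [hv.imp, hv.neg]; tauto
    · by_contra h'
      refine hcons (.mp (.mp (.thm ?_) (himp _ h)) (himp _ h'))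
      exact .of_valuation fun v hv => by simp only [hv.imp, hv.neg]; tauto

theorem MPStar.of_worlds {φ : Formula P} (h : ∀ w : World P, w.holds φ) : MPStar φ := by
  by_contra hφ
  have key : ∀ α, Derives (∅ : Set (Formula P)) α → MPStar α := fun α hα => by
    induction hα with
    | hyp h => exact h.elim
    | thm h => exact h
    | mp _ _ ih ih' => exact .modusPonens ih ih'
  obtain ⟨w, -, hw⟩ := exists_world fun h => hφ (key φ h)
  exact hw (h w)

/-! ### Modal facts at worlds -/

theorem MPStar.box_mono {α β : Formula P} (h : MPStar (imp α β)) : MPStar (imp (box α) (box β)) :=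
  .modusPonens (.boxDistrib _ _) (.boxNec h)

theorem MPStar.know_mono {α β : Formula P} (h : MPStar (imp α β)) :
    MPStar (imp (know α) (know β)) :=
  .modusPonens (.knowDistrib _ _) (.knowNec h)

theorem MPStar.contrapose {α β : Formula P} (h : MPStar (imp α β)) :
    MPStar (imp (neg β) (neg α)) :=
  .modusPonens (.of_valuation fun v hv => by simp only [hv.imp, hv.neg]; tauto) h

theorem MPStar.dia_mono {α β : Formula P} (h : MPStar (imp α β)) : MPStar (imp (dia α) (dia β)) :=
  h.contrapose.box_mono.contrapose

theorem MPStar.imp_trans {α β γ : Formula P} (h : MPStar (imp α β)) (h' : MPStar (imp β γ)) :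
    MPStar (imp α γ) :=
  .of_worlds fun w => (w.isBooleanValuation.imp α γ).2 fun hα => w.mp h' (w.mp h hα)

theorem MPStar.imp_dia (α : Formula P) : MPStar (imp α (dia α)) :=
  .of_worlds fun w => by
    have hv := w.isBooleanValuation
    have := w.of_mpStar (.boxRefl (Formula.neg α))
    simp only [hv.imp, hv.neg, dia] at this ⊢
    tauto

theorem MPStar.dia_dia (α : Formula P) : MPStar (imp (dia (dia α)) (dia α)) := by
  have h : MPStar (imp (box (neg α)) (box (neg (neg (box (neg α)))))) :=
    (MPStar.boxTrans _).imp_trans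
      (.box_mono (.of_valuation fun v hv => by simp only [hv.imp, hv.neg]; tauto))
  exact h.contrapose

theorem MPStar.box_and_dia (α β : Formula P) :
    MPStar (imp (and (box α) (dia β)) (dia (and α β))) :=
  .of_worlds fun w => by
    have hv := w.isBooleanValuation
    have h1 : MPStar (imp α (imp (neg (and α β)) (neg β))) :=
      .of_valuation fun v hv => by simp only [hv.imp, hv.neg, hv.and]; tauto
    have h2 := w.of_mpStar h1.box_mono
    have h3 := w.of_mpStar (.boxDistrib (neg (and α β)) (neg β))
    simp only [hv.imp, hv.neg, hv.and, dia] at h2 h3 ⊢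
    tauto

/-- Formulae of `L'` and their negations are persistent. -/
theorem persistent_of_inLPrime {φ : Formula P} (h : InLPrime φ) :
    MPStar (imp φ (box φ)) ∧ MPStar (imp (neg φ) (box (neg φ))) := by
  induction h with
  | atom a =>
    constructor <;> refine .of_worlds fun w => ?_ <;>
    have h := (w.isBooleanValuation.and _ _).1 (w.of_mpStar (.atomPersistent a))
    exacts [h.1, h.2]
  | @and φ ψ _ _ ihφ ihψ =>
    constructor
    · refine .of_worlds fun w => ?_
      have hv := w.isBooleanValuation
      have h1 : MPStar (imp φ (imp ψ (Formula.and φ ψ))) :=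
        .of_valuation fun v hv => by simp only [hv.imp, hv.and]; tauto
      have h2 := w.of_mpStar h1.box_mono
      have h3 := w.of_mpStar (.boxDistrib ψ (Formula.and φ ψ))
      have h4 := w.of_mpStar ihφ.1
      have h5 := w.of_mpStar ihψ.1
      simp only [hv.imp, hv.and] at h2 h3 h4 h5 ⊢
      tauto
    · refine .of_worlds fun w => ?_
      have hv := w.isBooleanValuation
      have h1 : MPStar (imp (Formula.neg φ) (Formula.neg (Formula.and φ ψ))) :=
        .of_valuation fun v hv => by simp only [hv.imp, hv.neg, hv.and]; tauto
      have h2 : MPStar (imp (Formula.neg ψ) (Formula.neg (Formula.and φ ψ))) :=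
        .of_valuation fun v hv => by simp only [hv.imp, hv.neg, hv.and]; tauto
      have h3 := w.of_mpStar h1.box_mono
      have h4 := w.of_mpStar h2.box_mono
      have h5 := w.of_mpStar ihφ.2
      have h6 := w.of_mpStar ihψ.2
      simp only [hv.imp, hv.neg, hv.and] at h3 h4 h5 h6 ⊢
      tauto
  | @neg φ _ ih =>
    refine ⟨ih.2, ?_⟩
    have h1 : MPStar (imp (Formula.neg (Formula.neg φ)) φ) :=
      .of_valuation fun v hv => by simp only [hv.imp, hv.neg]; tauto
    have h2 : MPStar (imp φ (Formula.neg (Formula.neg φ))) :=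
      .of_valuation fun v hv => by simp only [hv.imp, hv.neg]; tauto
    exact (h1.imp_trans ih.1).imp_trans h2.box_mono
  | @diaKnow φ _ ih =>
    constructor
    -- `Kφ → K□φ → □Kφ`, hence `◇Kφ → ◇□Kφ → □◇Kφ`.
    · exact ((ih.1.know_mono.imp_trans (.cross φ)).dia_mono).imp_trans (.directed _)
    · have h1 : MPStar (imp (Formula.neg (dia (know φ))) (box (Formula.neg (know φ)))) :=
        .of_valuation fun v hv => by simp only [dia, hv.imp, hv.neg]; tauto
      have h2 : MPStar (imp (box (Formula.neg (know φ))) (Formula.neg (dia (know φ)))) :=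
        .of_valuation fun v hv => by simp only [dia, hv.imp, hv.neg]; tauto
      exact (h1.imp_trans (.boxTrans _)).imp_trans h2.box_mono

theorem diaKnow_imp_self {φ : Formula P} (h : InLPrime φ) : MPStar (imp (dia (know φ)) φ) := by
  refine (MPStar.knowRefl φ).dia_mono.imp_trans (.of_worlds fun w => ?_)
  have hv := w.isBooleanValuation
  have := w.of_mpStar (persistent_of_inLPrime h).2
  simp only [hv.imp, hv.neg, dia] at this ⊢
  tauto

theorem diaKnow_imp_diaKnow_diaKnow (φ : Formula P) :
    MPStar (imp (dia (know φ)) (dia (know (dia (know φ))))) :=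
  ((MPStar.knowTrans φ).imp_trans (MPStar.imp_dia (know φ)).know_mono).dia_mono

/-- Both `◇Kφ` and `Kψ` are persistent: shrink to reach `Kψ`, then shrink again to reach `Kφ`
without losing it. -/
theorem diaKnow_and {φ ψ : Formula P} (hφ : InLPrime φ) (hψ : InLPrime ψ) :
    MPStar (imp (and (dia (know φ)) (dia (know ψ))) (dia (know (and φ ψ)))) := by
  have h1 := (persistent_of_inLPrime hφ.diaKnow).1
  have h2 : MPStar (imp (know ψ) (box (know ψ))) :=
    (persistent_of_inLPrime hψ).1.know_mono.imp_trans (.cross ψ)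
  have h3 : MPStar (imp (and (know ψ) (know φ)) (know (and φ ψ))) := .of_worlds fun w => by
    have hv := w.isBooleanValuation
    have h : MPStar (imp φ (imp ψ (and φ ψ))) :=
      .of_valuation fun v hv => by simp only [hv.imp, hv.and]; tauto
    have h' := w.of_mpStar h.know_mono
    have h'' := w.of_mpStar (.knowDistrib ψ (and φ ψ))
    simp only [hv.imp, hv.and] at h' h'' ⊢
    tauto
  have h4 : MPStar (imp (and (dia (know φ)) (know ψ)) (dia (know (and φ ψ)))) := by
    refine MPStar.imp_trans ?_ ((MPStar.box_and_dia (know ψ) (know φ)).imp_trans h3.dia_mono)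
    refine .of_worlds fun w => ?_
    have hv := w.isBooleanValuation
    have := w.of_mpStar h2
    simp only [hv.imp, hv.and] at this ⊢
    tauto
  refine MPStar.imp_trans (.of_worlds fun w => ?_)
    ((MPStar.box_and_dia (dia (know φ)) (know ψ)).imp_trans (h4.dia_mono.imp_trans (.dia_dia _)))
  have hv := w.isBooleanValuation
  have := w.of_mpStar h1
  simp only [hv.imp, hv.and] at this ⊢
  tauto

/-! ### The canonical topological model -/

/-- Accessibility for the modality `◇K` restricted to `L'`. -/
def World.Rel (w v : World P) : Prop :=
  ∀ φ, InLPrime φ → w.holds (dia (know φ)) → v.holds φ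

theorem World.Rel.refl (w : World P) : w.Rel w :=
  fun _ hφ h => w.mp (diaKnow_imp_self hφ) h

theorem World.Rel.holds_diaKnow {w v : World P} (h : w.Rel v) {φ : Formula P} (hφ : InLPrime φ)
    (hw : w.holds (dia (know φ))) : v.holds (dia (know φ)) :=
  h _ hφ.diaKnow (w.mp (diaKnow_imp_diaKnow_diaKnow φ) hw)

theorem World.Rel.trans {w v u : World P} (h : w.Rel v) (h' : v.Rel u) : w.Rel u :=
  fun _ hφ hw => h' _ hφ (h.holds_diaKnow hφ hw)

/-- Existence lemma for `◇K`: by `diaKnow_and`, whatever the `L'`-formulae `ψ` with `◇Kψ` in `w`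
derive already follows from one of them. -/
theorem World.holds_diaKnow_of_forall_rel (w : World P) {φ : Formula P}
    (h : ∀ v, w.Rel v → v.holds φ) : w.holds (dia (know φ)) := by
  have key : ∀ α, Derives {ψ | InLPrime ψ ∧ w.holds (dia (know ψ))} α →
      ∃ ψ, InLPrime ψ ∧ w.holds (dia (know ψ)) ∧ MPStar (imp ψ α) := fun α hα => by
    induction hα with
    | @hyp α h =>
      exact ⟨α, h.1, h.2, .of_valuation fun v hv => by simp [hv.imp]⟩
    | thm h =>
      have ht : MPStar (atom (P := P) Atom.top) := .of_valuation fun v hv => hv.top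
      exact ⟨atom Atom.top, .atom _, w.mp (.imp_dia _) (w.of_mpStar ht.knowNec),
        .modusPonens (.of_valuation fun v hv => by simp only [hv.imp]; tauto) h⟩
    | mp _ _ ih ih' =>
      obtain ⟨ψ, hψ, hw, h⟩ := ih
      obtain ⟨χ, hχ, hw', h'⟩ := ih'
      refine ⟨and ψ χ, hψ.and hχ,
        w.mp (diaKnow_and hψ hχ) ((w.isBooleanValuation.and _ _).2 ⟨hw, hw'⟩),
        .of_worlds fun u => ?_⟩
      have hv := u.isBooleanValuation
      have h1 := u.of_mpStar h
      have h2 := u.of_mpStar h'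
      simp only [hv.imp, hv.and] at h1 h2 ⊢
      tauto
  by_contra hw
  obtain ⟨v, hv, hvφ⟩ := exists_world (S := {ψ | InLPrime ψ ∧ w.holds (dia (know ψ))})
    (φ := φ) fun hd => by
      obtain ⟨ψ, _, hψ, h⟩ := key φ hd
      exact hw (w.mp h.know_mono.dia_mono hψ)
  exact hvφ (h v fun ψ hψ hwψ => hv ψ ⟨hψ, hwψ⟩)

/-- The topology of `World.Rel`-closed sets. -/
instance : TopologicalSpace (World P) where
  IsOpen U := ∀ w ∈ U, ∀ v, w.Rel v → v ∈ U
  isOpen_univ := fun _ _ _ _ => trivial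
  isOpen_inter := fun _ _ hU hW w hw v h => ⟨hU w hw.1 v h, hW w hw.2 v h⟩
  isOpen_sUnion := fun _ hc w ⟨U, hU, hw⟩ v h => ⟨U, hU, hc U hU w hw v h⟩

theorem World.isOpen_iff {U : Set (World P)} : IsOpen U ↔ ∀ w ∈ U, ∀ v, w.Rel v → v ∈ U :=
  Iff.rfl

/-- The canonical interpretation of the letters. -/
def canonicalLetters (p : P) : Set (World P) := {w | w.holds (atom (Atom.letter p))}

theorem sat_canonical_iff {φ : Formula P} (h : InLPrime φ) :
    ∀ (w : World P) (U : Set (World P)), IsOpen U → w ∈ U →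
      (Sat canonicalLetters w U φ ↔ w.holds φ) := by
  induction h with
  | atom a =>
    intro w U _ _
    cases a with
    | top => simp [Sat, w.isBooleanValuation.top]
    | bot => simp [Sat, w.isBooleanValuation.bot]
    | letter p => simp [Sat, canonicalLetters]
  | and _ _ ih ih' =>
    intro w U hU hw
    rw [w.isBooleanValuation.and, ← ih w U hU hw, ← ih' w U hU hw, Sat]
  | neg _ ih =>
    intro w U hU hw
    rw [w.isBooleanValuation.neg, ← ih w U hU hw, Sat]
  | @diaKnow φ hφ ih =>
    intro w U hU hw
    rw [sat_dia]
    constructor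
    · rintro ⟨W, hW, _, hwW, h⟩
      refine w.holds_diaKnow_of_forall_rel fun v hv => ?_
      have hvW : v ∈ W := World.isOpen_iff.1 hW w hwW v hv
      exact (ih v W hW hvW).1 (h v hvW)
    · intro h
      -- The successors of `w` form its least open neighbourhood, already contained in `U`.
      have hW : IsOpen (U ∩ {v | w.Rel v}) :=
        hU.inter (World.isOpen_iff.2 fun v hv u hu => World.Rel.trans hv hu)
      exact ⟨_, hW, Set.inter_subset_left, ⟨hw, .refl w⟩,
        fun v hv => (ih v _ hW hv).2 (hv.2 φ hφ h)⟩

/-! ### The disjunction property -/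

theorem exists_mpStar_know_imp {n : ℕ} (hn : 1 ≤ n) {φs : Fin n → Formula P}
    (hφs : ∀ i, InLPrime (φs i)) {φ : Formula P} (hφ : InLPrime φ)
    (h : MPStar (imp (know φ) (disj (List.ofFn fun i => know (φs i))))) :
    ∃ i, MPStar (imp (know φ) (φs i)) := by
  by_contra! hcon
  have hw : ∀ i, ∃ w : World P, w.holds (dia (know φ)) ∧ ¬ w.holds (φs i) := fun i => by
    by_contra! hi
    refine hcon i ((MPStar.imp_dia _).imp_trans (.of_worlds fun w => ?_))
    exact (w.isBooleanValuation.imp _ _).2 (hi w)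
  choose w hwφ hwi using hw
  -- `◇Kφ` is transmitted along `World.Rel`, which makes this set open.
  let U : Set (World P) := {v | v.holds (dia (know φ))}
  have hU : IsOpen U := World.isOpen_iff.2 fun v hv u hu => hu.holds_diaKnow hφ hv
  -- The base point is immaterial, as `K`-formulae depend only on `U`; `hn` supplies one.
  have hsat := sat_imp.1 (h.sat (V := canonicalLetters) (w ⟨0, hn⟩) U hU (hwφ _))
    fun v hv => (sat_canonical_iff hφ v U hU hv).2 (v.mp (diaKnow_imp_self hφ) hv)
  obtain ⟨α, hα, hs⟩ := (isBooleanValuation_sat.disj _).1 hsat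
  obtain ⟨i, rfl⟩ := (List.mem_ofFn' _ _).1 hα
  exact hwi i ((sat_canonical_iff (hφs i) (w i) U hU (hwφ i)).1 (hs (w i) (hwφ i)))

end TopologicMP

open TopologicMP TopologicMP.Formula in
/-- The disjunction property of `MP*` for the fragment `L'`, and its form relative to a
hypothesis `Kφ` with `φ` in `L'`. -/
theorem mainTheorem11 {P : Type*} [Countable P] (n : ℕ) (hn : 1 ≤ n)
    (φs : Fin n → Formula P) (hφs : ∀ i, InLPrime (φs i)) :
    (MPStar (disj (List.ofFn fun i => know (φs i))) → ∃ i, MPStar (φs i)) ∧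
    (∀ φ : Formula P, InLPrime φ →
      MPStar (imp (know φ) (disj (List.ofFn fun i => know (φs i)))) →
        ∃ i, MPStar (imp (know φ) (φs i))) := by
  refine ⟨fun h => ?_, fun φ hφ h => exists_mpStar_know_imp hn hφs hφ h⟩
  have ht : MPStar (atom (P := P) Atom.top) := .of_valuation fun v hv => hv.top
  -- The absolute form is the relative one with hypothesis `K⊤`, a theorem.
  obtain ⟨i, hi⟩ := exists_mpStar_know_imp hn hφs (.atom Atom.top)
    (.modusPonens (.of_valuation fun v hv => by simp only [hv.imp]; tauto) h)
  exact ⟨i, .modusPonens hi ht.knowNec⟩
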